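/- \textbf{Theorem (Disjunction Property of $\mathsf{L_{RBL}}$).} Fix a set $\mathsf{Prop}$ of propositional letters. Formulas are given by $$A ::= p \mid \bot \mid \top \mid A\wedge A \mid A\vee A \mid A\cdot A \mid A\to A \mid A\leftarrow A \qquad (p\in\mathsf{Prop}).$$ Formula structures are given by: every formula is a structure, and if $\Gamma,\Delta$ are structures, then so are $\Gamma\odot\Delta$ and $\Gamma\barwedge\Delta$ (there is no empty structure). $\Gamma[-]$ denotes a structure with one hole (possibly the bare hole), and $\Gamma[\Delta]$ the result of putting $\Delta$ into the hole. Sequents have the form $\Gamma\Rightarrow A$ with $\Gamma$ a structure and $A$ a formula. The calculus $\mathsf{L_{RBL}}$ has the axioms $A\Rightarrow A$, $A\Rightarrow\top$, $\bot\Rightarrow A$, and the following rules (premises before the slash, conclusion after it): - $(\to\mathrm L)$ $\Delta\Rightarrow A,\ \Gamma[B]\Rightarrow C\ /\ \Gamma[\Delta\odot(A\to B)]\Rightarrow C$; $(\to\mathrm R)$ $A\odot\Gamma\Rightarrow B\ /\ \Gamma\Rightarrow A\to B$; - $(\leftarrow\mathrm L)$ $\Gamma[A]\Rightarrow C,\ \Delta\Rightarrow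 B\ /\ \Gamma[(A\leftarrow B)\odot\Delta]\Rightarrow C$; $(\leftarrow\mathrm R)$ $\Gamma\odot B\Rightarrow A\ /\ \Gamma\Rightarrow A\leftarrow B$; - $(\cdot\mathrm L)$ $\Gamma[A\odot B]\Rightarrow C\ /\ \Gamma[A\cdot B]\Rightarrow C$; $(\cdot\mathrm R)$ $\Gamma\Rightarrow A,\ \Delta\Rightarrow B\ /\ \Gamma\odot\Delta\Rightarrow A\cdot B$; - $(\wedge\mathrm L)$ $\Gamma[A\barwedge B]\Rightarrow C\ /\ \Gamma[A\wedge B]\Rightarrow C$; $(\wedge\mathrm R)$ $\Gamma\Rightarrow A,\ \Gamma\Rightarrow B\ /\ \Gamma\Rightarrow A\wedge B$; - $(\vee\mathrm L)$ $\Gamma[A]\Rightarrow C,\ \Gamma[B]\Rightarrow C\ /\ \Gamma[A\vee B]\Rightarrow C$; $(\vee\mathrm R)$ $\Gamma\Rightarrow A_i\ /\ \Gamma\Rightarrow A_1\vee A_2$ for $i=1,2$; - contraction: $\Gamma[\Delta\barwedge\Delta]\Rightarrow A\ /\ \Gamma[\Delta]\Rightarrow A$ and $\Gamma[(\Lambda\odot\Delta)\odot\Delta]\Rightarrow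 A\ /\ \Gamma[\Lambda\odot\Delta]\Rightarrow A$; - exchange: $\Gamma[\Delta\barwedge\Lambda]\Rightarrow A\ /\ \Gamma[\Lambda\barwedge\Delta]\Rightarrow A$; - weakening, for $*\in\{\barwedge,\odot\}$: $\Gamma[\Delta]\Rightarrow A\ /\ \Gamma[\Delta'*\Delta]\Rightarrow A$ and $\Gamma[\Delta]\Rightarrow A\ /\ \Gamma[\Delta*\Delta']\Rightarrow A$; - associativity, in both directions: $\Gamma[(\Delta_1\barwedge\Delta_2)\barwedge\Delta_3]\Rightarrow A\ /\ \Gamma[\Delta_1\barwedge(\Delta_2\barwedge\Delta_3)]\Rightarrow A$ and conversely; - $(\mathrm{Cut})$ $\Delta\Rightarrow A,\ \Gamma[A]\Rightarrow B\ /\ \Gamma[\Delta]\Rightarrow B$. Then for all formulas $A$ and $B$: if $\top\Rightarrow A\vee B$ is derivable in $\mathsf{L_{RBL}}$, then $\top\Rightarrow A$ is derivable in $\mathsf{L_{RBL}}$ or $\top\Rightarrow B$ is derivable in $\mathsf{L_{RBL}}$. -/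

import Mathlib

namespace RBL

/-- Formulas of the language of residuated basic logic over a type `α` of propositional letters. -/
inductive Formula (α : Type*) where
  /-- a propositional letter -/
  | var (p : α)
  /-- `⊥` -/
  | bot
  /-- `⊤` -/
  | top
  /-- `A ∧ B` -/
  | and (A B : Formula α)
  /-- `A ∨ B` -/
  | or (A B : Formula α)
  /-- the product `A · B` -/
  | prod (A B : Formula α)
  /-- `A → B` -/
  | imp (A B : Formula α)
  /-- `A ← B` -/
  | coimp (A B : Formula α)

/-- Formula structures: built from formulas with the two structural operations `⊙` and `⩕`.
There is no empty structure. -/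
inductive FStruct (α : Type*) where
  /-- a formula, as a structure -/
  | of (A : Formula α)
  /-- `Γ ⊙ Δ` -/
  | odot (Γ Δ : FStruct α)
  /-- `Γ ⩕ Δ` -/
  | owedge (Γ Δ : FStruct α)

/-- Contexts `Γ[-]`: formula structures with exactly one hole. -/
inductive Ctx (α : Type*) where
  /-- the trivial context `[-]` -/
  | hole
  /-- `Γ[-] ⊙ Δ` -/
  | odotL (Γ : Ctx α) (Δ : FStruct α)
  /-- `Δ ⊙ Γ[-]` -/
  | odotR (Δ : FStruct α) (Γ : Ctx α)
  /-- `Γ[-] ⩕ Δ` -/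
  | owedgeL (Γ : Ctx α) (Δ : FStruct α)
  /-- `Δ ⩕ Γ[-]` -/
  | owedgeR (Δ : FStruct α) (Γ : Ctx α)

/-- `Γ.fill Θ` is the structure `Γ[Θ]`. -/
def Ctx.fill {α : Type*} : Ctx α → FStruct α → FStruct α
  | .hole, Θ => Θ
  | .odotL Γ Δ, Θ => .odot (Γ.fill Θ) Δ
  | .odotR Δ Γ, Θ => .odot Δ (Γ.fill Θ)
  | .owedgeL Γ Δ, Θ => .owedge (Γ.fill Θ) Δ
  | .owedgeR Δ Γ, Θ => .owedge Δ (Γ.fill Θ)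

/-- `LRBL Γ A`: the sequent `Γ ⇒ A` is derivable in the sequent calculus `L_RBL` (with cut).
The provisos of `impR`, `coimpR` and `odotC`, that a structure be non-empty, hold automatically. -/
inductive LRBL {α : Type*} : FStruct α → Formula α → Prop where
  /-- (Id) -/
  | id (A : Formula α) : LRBL (.of A) A
  /-- (⊤) -/
  | top (A : Formula α) : LRBL (.of A) .top
  /-- (⊥) -/
  | bot (A : Formula α) : LRBL (.of .bot) A
  /-- (→L) -/
  | impL (Γ : Ctx α) (Δ : FStruct α) (A B C : Formula α) :
      LRBL Δ A → LRBL (Γ.fill (.of B)) C → LRBL (Γ.fill (.odot Δ (.of (.imp A B)))) C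
  /-- (→R) -/
  | impR (Γ : FStruct α) (A B : Formula α) : LRBL (.odot (.of A) Γ) B → LRBL Γ (.imp A B)
  /-- (←L) -/
  | coimpL (Γ : Ctx α) (Δ : FStruct α) (A B C : Formula α) :
      LRBL (Γ.fill (.of A)) C → LRBL Δ B → LRBL (Γ.fill (.odot (.of (.coimp A B)) Δ)) C
  /-- (←R) -/
  | coimpR (Γ : FStruct α) (A B : Formula α) : LRBL (.odot Γ (.of B)) A → LRBL Γ (.coimp A B)
  /-- (·L) -/
  | prodL (Γ : Ctx α) (A B C : Formula α) :
      LRBL (Γ.fill (.odot (.of A) (.of B))) C → LRBL (Γ.fill (.of (.prod A B))) C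
  /-- (·R) -/
  | prodR (Γ Δ : FStruct α) (A B : Formula α) :
      LRBL Γ A → LRBL Δ B → LRBL (.odot Γ Δ) (.prod A B)
  /-- (∧L) -/
  | andL (Γ : Ctx α) (A B C : Formula α) :
      LRBL (Γ.fill (.owedge (.of A) (.of B))) C → LRBL (Γ.fill (.of (.and A B))) C
  /-- (∧R) -/
  | andR (Γ : FStruct α) (A B : Formula α) : LRBL Γ A → LRBL Γ B → LRBL Γ (.and A B)
  /-- (∨L) -/
  | orL (Γ : Ctx α) (A B C : Formula α) :
      LRBL (Γ.fill (.of A)) C → LRBL (Γ.fill (.of B)) C → LRBL (Γ.fill (.of (.or A B))) C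
  /-- (∨R), `i = 1` -/
  | orR₁ (Γ : FStruct α) (A B : Formula α) : LRBL Γ A → LRBL Γ (.or A B)
  /-- (∨R), `i = 2` -/
  | orR₂ (Γ : FStruct α) (A B : Formula α) : LRBL Γ B → LRBL Γ (.or A B)
  /-- (⩕C) -/
  | owedgeC (Γ : Ctx α) (Δ : FStruct α) (A : Formula α) :
      LRBL (Γ.fill (.owedge Δ Δ)) A → LRBL (Γ.fill Δ) A
  /-- (⊙C), the restricted contraction -/
  | odotC (Γ : Ctx α) (Θ Δ : FStruct α) (A : Formula α) :
      LRBL (Γ.fill (.odot (.odot Θ Δ) Δ)) A → LRBL (Γ.fill (.odot Θ Δ)) A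
  /-- (⩕E) -/
  | owedgeE (Γ : Ctx α) (Δ Θ : FStruct α) (A : Formula α) :
      LRBL (Γ.fill (.owedge Δ Θ)) A → LRBL (Γ.fill (.owedge Θ Δ)) A
  /-- (Cut) -/
  | cut (Γ : Ctx α) (Δ : FStruct α) (A B : Formula α) :
      LRBL Δ A → LRBL (Γ.fill (.of A)) B → LRBL (Γ.fill Δ) B
  /-- (W¹) for `⩕` -/
  | owedgeW₁ (Γ : Ctx α) (Δ Δ' : FStruct α) (A : Formula α) :
      LRBL (Γ.fill Δ) A → LRBL (Γ.fill (.owedge Δ' Δ)) A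
  /-- (W¹) for `⊙` -/
  | odotW₁ (Γ : Ctx α) (Δ Δ' : FStruct α) (A : Formula α) :
      LRBL (Γ.fill Δ) A → LRBL (Γ.fill (.odot Δ' Δ)) A
  /-- (W²) for `⩕` -/
  | owedgeW₂ (Γ : Ctx α) (Δ Δ' : FStruct α) (A : Formula α) :
      LRBL (Γ.fill Δ) A → LRBL (Γ.fill (.owedge Δ Δ')) A
  /-- (W²) for `⊙` -/
  | odotW₂ (Γ : Ctx α) (Δ Δ' : FStruct α) (A : Formula α) :
      LRBL (Γ.fill Δ) A → LRBL (Γ.fill (.odot Δ Δ')) A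
  /-- (⩕A¹) -/
  | owedgeA₁ (Γ : Ctx α) (Δ₁ Δ₂ Δ₃ : FStruct α) (A : Formula α) :
      LRBL (Γ.fill (.owedge (.owedge Δ₁ Δ₂) Δ₃)) A → LRBL (Γ.fill (.owedge Δ₁ (.owedge Δ₂ Δ₃))) A
  /-- (⩕A²) -/
  | owedgeA₂ (Γ : Ctx α) (Δ₁ Δ₂ Δ₃ : FStruct α) (A : Formula α) :
      LRBL (Γ.fill (.owedge Δ₁ (.owedge Δ₂ Δ₃))) A → LRBL (Γ.fill (.owedge (.owedge Δ₁ Δ₂) Δ₃)) A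

end RBL

/-! The proof is a Kleene–Aczel slash argument, carried out on derivations with cut. Fix a structure
`X` and let `A.Slash X` be a strengthening of the derivability of `X ⇒ A` that makes `∨` prime: a
disjunction is slashed only if one of its disjuncts is. Structures are slashed when read with `⩕` as
conjunction and `⊙` as falsity. Every derivable sequent transports the slash from left to right.
The axiom for `⊤` and the right rules for the two implications need a derivation from `X` itself;
it exists because `X` entails every structure that it slashes.
If `X` slashes itself, as `⊤` does, then `X ⇒ A ∨ B` slashes `A` or `B`. -/

namespace RBL

variable {α : Type*}

/-- Composition of contexts: `Γ.comp K` is `Γ[K[-]]`. -/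
def Ctx.comp : Ctx α → Ctx α → Ctx α
  | .hole, K => K
  | .odotL Γ Δ, K => .odotL (Γ.comp K) Δ
  | .odotR Δ Γ, K => .odotR Δ (Γ.comp K)
  | .owedgeL Γ Δ, K => .owedgeL (Γ.comp K) Δ
  | .owedgeR Δ Γ, K => .owedgeR Δ (Γ.comp K)

theorem Ctx.fill_comp (Γ K : Ctx α) (Θ : FStruct α) :
    (Γ.comp K).fill Θ = Γ.fill (K.fill Θ) := by
  induction Γ <;> simp_all only [Ctx.comp, Ctx.fill]

/-- The preorder of structural entailment: `Δ ≤ Θ` if `Δ` may replace `Θ` in the antecedent of every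
derivable sequent. -/
instance : Preorder (FStruct α) where
  le Δ Θ := ∀ (Γ : Ctx α) (A : Formula α), LRBL (Γ.fill Θ) A → LRBL (Γ.fill Δ) A
  le_refl _ _ _ d := d
  le_trans _ _ _ h₁ h₂ Γ A d := h₁ Γ A (h₂ Γ A d)

theorem LRBL.of_le {Δ Θ : FStruct α} {A : Formula α} (h : Δ ≤ Θ) (d : LRBL Θ A) : LRBL Δ A :=
  h .hole A d

theorem FStruct.le_of_iff {Δ : FStruct α} {A : Formula α} : Δ ≤ .of A ↔ LRBL Δ A :=
  ⟨fun h => .of_le h (.id A), fun d Γ C => .cut Γ Δ A C d⟩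

theorem Ctx.fill_mono (Γ : Ctx α) : Monotone Γ.fill := by
  intro Δ Θ h K A d
  rw [← Ctx.fill_comp] at d ⊢
  exact h _ A d

theorem FStruct.owedge_le_left (Δ Θ : FStruct α) : .owedge Δ Θ ≤ Δ :=
  fun Γ => .owedgeW₂ Γ Δ Θ

theorem FStruct.owedge_le_right (Δ Θ : FStruct α) : .owedge Δ Θ ≤ Θ :=
  fun Γ => .owedgeW₁ Γ Θ Δ

theorem FStruct.le_owedge {Γ Δ Θ : FStruct α} (hΔ : Γ ≤ Δ) (hΘ : Γ ≤ Θ) : Γ ≤ .owedge Δ Θ :=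
  calc
    Γ ≤ .owedge Γ Γ := fun K => .owedgeC K Γ
    _ ≤ .owedge Δ Γ := (Ctx.owedgeL .hole Γ).fill_mono hΔ
    _ ≤ .owedge Δ Θ := (Ctx.owedgeR Δ .hole).fill_mono hΘ

theorem LRBL.and_left {Γ : FStruct α} {A B : Formula α} (d : LRBL Γ (.and A B)) : LRBL Γ A :=
  .cut .hole Γ _ A d (.andL .hole A B A (.owedgeW₂ .hole _ _ A (.id A)))

theorem LRBL.and_right {Γ : FStruct α} {A B : Formula α} (d : LRBL Γ (.and A B)) : LRBL Γ B :=
  .cut .hole Γ _ B d (.andL .hole A B B (.owedgeW₁ .hole _ _ B (.id B)))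

/-- The slash `X ∣ A`, by recursion on `A`. It strengthens the derivability of `X ⇒ A` by making
disjunctions prime. Products, like `⊥`, are never slashed; there is no recursion into implications.
Algebraically, for `X = ⊤`: the value of `A` is the new top element when a top is adjoined to the
Lindenbaum algebra and all products are computed in the old algebra. -/
def Formula.Slash : Formula α → FStruct α → Prop
  | .var p, X => LRBL X (.var p)
  | .bot, _ => False
  | .top, X => LRBL X .top
  | .and A B, X => A.Slash X ∧ B.Slash X
  | .or A B, X => A.Slash X ∨ B.Slash X
  | .prod _ _, _ => False
  | .imp A B, X => LRBL X (.imp A B)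
  | .coimp A B, X => LRBL X (.coimp A B)

/-- The slash `X ∣ Γ` of a structure: `⩕` is read as `∧`, and `⊙` as the product. -/
def FStruct.Slash : FStruct α → FStruct α → Prop
  | .of A, X => A.Slash X
  | .odot _ _, _ => False
  | .owedge Γ Δ, X => Γ.Slash X ∧ Δ.Slash X

/-- The condition on a context under which filling it with a slashed structure gives a slashed
structure. -/
def Ctx.Slash : Ctx α → FStruct α → Prop
  | .hole, _ => True
  | .odotL _ _, _ => False
  | .odotR _ _, _ => False
  | .owedgeL Γ Δ, X => Γ.Slash X ∧ Δ.Slash X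
  | .owedgeR Δ Γ, X => Δ.Slash X ∧ Γ.Slash X

variable {X : FStruct α}

theorem Ctx.slash_fill_iff (Γ : Ctx α) (Δ : FStruct α) :
    (Γ.fill Δ).Slash X ↔ Γ.Slash X ∧ Δ.Slash X := by
  induction Γ with
  | hole => simp only [Ctx.fill, Ctx.Slash, true_and]
  | odotL | odotR => simp only [Ctx.fill, FStruct.Slash, Ctx.Slash, false_and]
  | owedgeL Γ Θ ih => simp only [Ctx.fill, FStruct.Slash, Ctx.Slash, ih, and_right_comm]
  | owedgeR Θ Γ ih => simp only [Ctx.fill, FStruct.Slash, Ctx.Slash, ih, and_assoc]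

theorem Formula.Slash.lrbl {A : Formula α} (h : A.Slash X) : LRBL X A := by
  induction A with
  | var | top | imp | coimp => exact h
  | bot | prod => exact h.elim
  | and A B ihA ihB => exact .andR X A B (ihA h.1) (ihB h.2)
  | or A B ihA ihB => exact h.elim (.orR₁ X A B ∘ ihA) (.orR₂ X A B ∘ ihB)

theorem FStruct.Slash.le {Δ : FStruct α} (h : Δ.Slash X) : X ≤ Δ := by
  induction Δ with
  | of A => exact FStruct.le_of_iff.2 (Formula.Slash.lrbl h)
  | odot => exact h.elim
  | owedge Δ Θ ihΔ ihΘ => exact FStruct.le_owedge (ihΔ h.1) (ihΘ h.2)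

theorem LRBL.slash {Γ : FStruct α} {A : Formula α} (d : LRBL Γ A) (s : Γ.Slash X) :
    A.Slash X := by
  induction d with
  | id => exact s
  | top A => exact (LRBL.top A).of_le s.le
  | bot => exact s.elim
  | impR Γ A B d => exact (LRBL.impR Γ A B d).of_le s.le
  | coimpR Γ A B d => exact (LRBL.coimpR Γ A B d).of_le s.le
  | prodR => exact s.elim
  | andR _ _ _ _ _ ihA ihB => exact ⟨ihA s, ihB s⟩
  | orR₁ _ _ _ _ ihA => exact .inl (ihA s)
  | orR₂ _ _ _ _ ihB => exact .inr (ihB s)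
  | cut Γ Δ A B _ _ ihA ihB =>
    rw [Ctx.slash_fill_iff] at s ihB
    exact ihB ⟨s.1, ihA s.2⟩
  | impL | coimpL | prodL | odotC | odotW₁ | odotW₂ =>
    exact ((Ctx.slash_fill_iff _ _).1 s).2.elim
  | andL | orL | owedgeC | owedgeE | owedgeW₁ | owedgeW₂ | owedgeA₁ | owedgeA₂ =>
    simp only [Ctx.slash_fill_iff, FStruct.Slash, Formula.Slash] at *
    tauto

/-- Formulas in which `⊥`, `∨` and `·` occur only within the scope of an implication. As the slash
does not recurse into implications, their consequents are unrestricted, unlike those of Harrop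
formulas of intuitionistic logic. -/
def Formula.IsHarrop : Formula α → Prop
  | .var _ => True
  | .bot => False
  | .top => True
  | .and A B => A.IsHarrop ∧ B.IsHarrop
  | .or _ _ => False
  | .prod _ _ => False
  | .imp _ _ => True
  | .coimp _ _ => True

/-- Structures composed of Harrop formulas by `⩕` alone. -/
def FStruct.IsHarrop : FStruct α → Prop
  | .of A => A.IsHarrop
  | .odot _ _ => False
  | .owedge Γ Δ => Γ.IsHarrop ∧ Δ.IsHarrop

theorem Formula.IsHarrop.slash {A : Formula α} (hA : A.IsHarrop) (d : LRBL X A) : A.Slash X := by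
  induction A with
  | var | top | imp | coimp => exact d
  | bot | or | prod => exact hA.elim
  | and A B ihA ihB => exact ⟨ihA hA.1 d.and_left, ihB hA.2 d.and_right⟩

theorem FStruct.IsHarrop.slash {Δ : FStruct α} (hΔ : Δ.IsHarrop) (h : X ≤ Δ) : Δ.Slash X := by
  induction Δ with
  | of A => exact Formula.IsHarrop.slash hΔ (FStruct.le_of_iff.1 h)
  | odot => exact hΔ.elim
  | owedge Δ Θ ihΔ ihΘ =>
    exact ⟨ihΔ hΔ.1 (h.trans (FStruct.owedge_le_left Δ Θ)),
      ihΘ hΔ.2 (h.trans (FStruct.owedge_le_right Δ Θ))⟩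

end RBL

theorem mainTheorem4_general {α : Type*} {Γ : RBL.FStruct α} (hΓ : Γ.IsHarrop)
    {A B : RBL.Formula α} (h : RBL.LRBL Γ (.or A B)) : RBL.LRBL Γ A ∨ RBL.LRBL Γ B := by
  have slash_or : A.Slash Γ ∨ B.Slash Γ := h.slash (hΓ.slash le_rfl)
  exact slash_or.imp RBL.Formula.Slash.lrbl RBL.Formula.Slash.lrbl

theorem mainTheorem4 {α : Type*} (A B : RBL.Formula α)
    (h : RBL.LRBL (RBL.FStruct.of RBL.Formula.top) (RBL.Formula.or A B)) :
    RBL.LRBL (RBL.FStruct.of RBL.Formula.top) A ∨ RBL.LRBL (RBL.FStruct.of RBL.Formula.top) B := by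
  exact mainTheorem4_general (Γ := .of .top) trivial h
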